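/- All graphs are finite, simple and undirected. A \emph{Grundy $k$-coloring} of a graph $G$ is a surjective map $c:V(G)\to\{1,\dots,k\}$ such that $c(u)\ne c(v)$ for every edge $uv$, and such that every vertex of color $i$ has, for every $j<i$, at least one neighbor of color $j$. The \emph{Grundy number} $\Gamma(G)$ is the largest $k$ for which $G$ has a Grundy $k$-coloring. For a vertex $v$ let $N(v)$ be the set of its neighbors. A set $X\subseteq V(G)$ is an \emph{independent module} if $X$ is independent and all vertices of $X$ have the same neighborhood. Let $\ell\ge 1$ be an integer. - A vertex $v$ of an $r$-regular graph $G$ is a \emph{$(0,\ell)$-twin-vertex} if some independent module of cardinality $r+2-\ell$ contains $v$. (For $r=\ell=3$: there is a vertex $x\neq v$ with $N(x)=N(v)$.) - A vertex $v$ is a \emph{$(1,\ell)$-twin-vertex} if $N(v)$ can be partitioned into at most $\ell-1$ nonempty independent modules. - A vertex $v$ is a \emph{$(2,\ell)$-twin-vertex} if $N(v)$ is an independent set and every vertex of $N(v)$ is a $(1,\ell)$-twin-vertex. **Theorem.** Let $G$ be a cubic (that is, $3$-regular) graph, not necessarily connected. Then $\Gamma(G)\le 3$ if and only if every vertex of $G$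 is an $(i,3)$-twin-vertex for some $i\in\{0,1,2\}$. -/

import Mathlib

namespace SimpleGraph

/-- A Grundy `k`-coloring: a proper coloring that uses exactly the colors `1, …, k` and in which
every vertex of color `i` has a neighbor of color `j`, for each color `j < i`. -/
structure IsGrundyColoring {V : Type*} (G : SimpleGraph V) (k : ℕ) (c : V → ℕ) : Prop where
  range_eq : Set.range c = Set.Icc 1 k
  proper : ∀ u v, G.Adj u v → c u ≠ c v
  grundy : ∀ v j, 1 ≤ j → j < c v → ∃ u, G.Adj v u ∧ c u = j

/-- The Grundy number of a (finite) graph: the largest `k` such that the graph has a Grundy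
`k`-coloring. For finite graphs the maximum exists, see `isGreatest_grundyNumber`. -/
noncomputable def grundyNumber {V : Type*} (G : SimpleGraph V) : ℕ :=
  sSup {k | ∃ c : V → ℕ, G.IsGrundyColoring k c}

/-- On a finite graph the supremum defining the Grundy number is a maximum. -/
theorem isGreatest_grundyNumber {V : Type*} [Fintype V] (G : SimpleGraph V) :
    IsGreatest {k | ∃ c : V → ℕ, G.IsGrundyColoring k c} G.grundyNumber := by
  classical
  have hbdd : BddAbove {k | ∃ c : V → ℕ, G.IsGrundyColoring k c} := by
    refine ⟨Fintype.card V, ?_⟩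
    rintro k ⟨c, hc⟩
    have h : Finset.univ.image c = Finset.Icc 1 k := by
      apply Finset.coe_injective
      simpa using hc.range_eq
    have h2 : (Finset.univ.image c).card ≤ Fintype.card V := Finset.card_image_le
    rw [h] at h2
    simpa using h2
  have hne : {k | ∃ c : V → ℕ, G.IsGrundyColoring k c}.Nonempty := by
    -- a proper coloring by positive integers with minimal color sum is a Grundy coloring
    let P : (V → ℕ) → Prop := fun c => (∀ v, 1 ≤ c v) ∧ ∀ u v, G.Adj u v → c u ≠ c v
    have hP : ∃ n, ∃ c, P c ∧ ∑ v, c v = n := by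
      refine ⟨_, fun v => (Fintype.equivFin V v : ℕ) + 1, ⟨fun v => Nat.le_add_left 1 _, ?_⟩, rfl⟩
      intro u v huv h
      apply huv.ne
      apply (Fintype.equivFin V).injective
      apply Fin.ext
      simpa using h
    obtain ⟨c, ⟨hpos, hprop⟩, hsum⟩ := Nat.find_spec hP
    have hgr : ∀ v j, 1 ≤ j → j < c v → ∃ u, G.Adj v u ∧ c u = j := by
      intro v j hj hjv
      by_contra hcon
      push Not at hcon
      have hlt : ∑ w, Function.update c v j w < ∑ w, c w := by
        apply Finset.sum_lt_sum
        · intro w _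
          by_cases hw : w = v
          · subst hw; simpa using hjv.le
          · simp [hw]
        · exact ⟨v, Finset.mem_univ v, by simpa using hjv⟩
      refine Nat.find_min hP (hsum ▸ hlt) ⟨_, ⟨?_, ?_⟩, rfl⟩
      · intro w
        by_cases hw : w = v
        · subst hw; simpa using hj
        · simpa [hw] using hpos w
      · intro a b hab
        by_cases ha : a = v
        · subst ha
          have hb : b ≠ a := hab.ne'
          simpa [hb] using (hcon b hab).symm
        · by_cases hb : b = v
          · subst hb
            simpa [ha] using hcon a hab.symm
          · simpa [ha, hb] using hprop a b hab
    refine ⟨Finset.univ.sup c, c, ?_, hprop, hgr⟩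
    ext j
    simp only [Set.mem_range, Set.mem_Icc]
    constructor
    · rintro ⟨v, rfl⟩
      exact ⟨hpos v, Finset.le_sup (Finset.mem_univ v)⟩
    · rintro ⟨h1, h2⟩
      obtain ⟨v, -, hv⟩ := (Finset.le_sup_iff (Nat.lt_of_lt_of_le Nat.zero_lt_one h1)).1 h2
      rcases hv.eq_or_lt with h | h
      · exact ⟨v, h.symm⟩
      · obtain ⟨u, -, hu⟩ := hgr v j h1 h
        exact ⟨u, hu⟩
  exact ⟨Nat.sSup_mem hne hbdd, fun k hk => le_csSup hbdd hk⟩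

/-- A set of vertices is an independent module if it is independent and all of its vertices have
the same neighborhood. -/
def IsIndependentModule {V : Type*} (G : SimpleGraph V) (X : Set V) : Prop :=
  G.IsIndepSet X ∧ ∀ x ∈ X, ∀ y ∈ X, G.neighborSet x = G.neighborSet y

/-- A vertex `v` of an `r`-regular graph is a `(0, ℓ)`-twin-vertex if it belongs to an independent
module of cardinality `r + 2 - ℓ`. -/
def IsZeroTwinVertex {V : Type*} (G : SimpleGraph V) (r l : ℕ) (v : V) : Prop :=
  ∃ X : Finset V, v ∈ X ∧ X.card + l = r + 2 ∧ G.IsIndependentModule (X : Set V)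

/-- A vertex `v` is a `(1, ℓ)`-twin-vertex if `N(v)` can be partitioned into at most `ℓ - 1`
(nonempty) independent modules. -/
def IsOneTwinVertex {V : Type*} (G : SimpleGraph V) (l : ℕ) (v : V) : Prop :=
  ∃ P : Finpartition (G.neighborSet v), P.parts.card + 1 ≤ l ∧
    ∀ X ∈ P.parts, G.IsIndependentModule X

/-- A vertex `v` is a `(2, ℓ)`-twin-vertex if `N(v)` is independent and every vertex of `N(v)` is
a `(1, ℓ)`-twin-vertex. -/
def IsTwoTwinVertex {V : Type*} (G : SimpleGraph V) (l : ℕ) (v : V) : Prop :=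
  G.IsIndepSet (G.neighborSet v) ∧ ∀ u ∈ G.neighborSet v, G.IsOneTwinVertex l u

end SimpleGraph

namespace SimpleGraph

/-! Twins (vertices with equal neighborhoods) get equal colors in every Grundy coloring
(`IsGrundyColoring.eq_of_neighborSet_eq`). A vertex v of color 4 and its neighbor a of color 3 each
see three distinct colors, so in a cubic graph neither has twin neighbors; each twin condition at v
contradicts this.

Conversely, a color 4 is certified by a partial Grundy coloring of at most eight vertices, and such
a pattern always extends to the whole graph. If Γ ≤ 3, every attempt to place the pattern therefore
meets a forbidden edge (`NoFourWitness`). Around a vertex v with neither a twin nor twin neighbors,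
these forced edges exclude triangles (`NoFourWitness.indep`) and 4-cycles
(`NoFourWitness.no_square`), and then give every neighbor of v twin neighbors
(`NoFourWitness.hasTwinNeighbors`), so v is a (2,3)-twin-vertex. -/

variable {V : Type*} {G : SimpleGraph V}

/-! ### Extending partial colorings to force color 4 -/

/-- A partial Grundy coloring (of the subgraph induced by `S`) extends to a Grundy coloring. -/
theorem exists_isGrundyColoring_extending [Fintype V] (G : SimpleGraph V) (S : Set V) (p : V → ℕ)
    (hpos : ∀ v ∈ S, 1 ≤ p v) (hprop : ∀ u ∈ S, ∀ v ∈ S, G.Adj u v → p u ≠ p v)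
    (hgr : ∀ v ∈ S, ∀ j, 1 ≤ j → j < p v → ∃ u ∈ S, G.Adj v u ∧ p u = j) :
    ∃ k c, G.IsGrundyColoring k c ∧ ∀ v ∈ S, c v = p v := by
  classical
  let P : (V → ℕ) → Prop := fun c =>
    (∀ v, 1 ≤ c v) ∧ (∀ u v, G.Adj u v → c u ≠ c v) ∧ ∀ v ∈ S, c v = p v
  have hP : ∃ n, ∃ c, P c ∧ ∑ v, c v = n := by
    -- `m` bounds every value of `p`, so vertices outside `S` can take pairwise distinct colors
    -- above all those used on `S`.
    let m := ∑ v, p v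
    have hm : ∀ v, p v ≤ m := fun v => Finset.single_le_sum (by simp) (Finset.mem_univ v)
    refine ⟨_, fun v => if v ∈ S then p v else m + (Fintype.equivFin V v : ℕ) + 1,
      ⟨fun v => ?_, fun u v huv => ?_, fun v hv => by simp [hv]⟩, rfl⟩
    · by_cases hv : v ∈ S
      · simpa [hv] using hpos v hv
      · simp [hv]
    · have hu := hm u
      have hv := hm v
      have hne : (Fintype.equivFin V u : ℕ) ≠ Fintype.equivFin V v := fun h =>
        huv.ne ((Fintype.equivFin V).injective (Fin.ext h))
      by_cases huS : u ∈ S <;> by_cases hvS : v ∈ S <;> simp only [huS, hvS, if_true, if_false]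
      · exact hprop u huS v hvS huv
      · lia
      · lia
      · lia
  obtain ⟨c, ⟨hcpos, hcprop, hcS⟩, hsum⟩ := Nat.find_spec hP
  have hcgr : ∀ v j, 1 ≤ j → j < c v → ∃ u, G.Adj v u ∧ c u = j := by
    intro v j hj hjv
    by_cases hvS : v ∈ S
    · obtain ⟨u, huS, hvu, hu⟩ := hgr v hvS j hj (hcS v hvS ▸ hjv)
      exact ⟨u, hvu, (hcS u huS).trans hu⟩
    -- Outside `S`, moving `v` down to a missing color `j` stays proper and agrees with `p`, but
    -- lowers the minimal color sum.
    by_contra! hcon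
    have hlt : ∑ w, Function.update c v j w < ∑ w, c w := by
      apply Finset.sum_lt_sum
      · intro w _
        by_cases hw : w = v
        · subst hw; simpa using hjv.le
        · simp [hw]
      · exact ⟨v, Finset.mem_univ v, by simpa using hjv⟩
    refine Nat.find_min hP (hsum ▸ hlt) ⟨_, ⟨fun w => ?_, fun a b hab => ?_, fun w hw => ?_⟩, rfl⟩
    · by_cases hw : w = v
      · subst hw; simpa using hj
      · simpa [hw] using hcpos w
    · by_cases ha : a = v
      · subst ha
        simpa [hab.ne'] using (hcon b hab).symm
      · by_cases hb : b = v
        · subst hb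
          simpa [ha] using hcon a hab.symm
        · simpa [ha, hb] using hcprop a b hab
    · have : w ≠ v := fun h => hvS (h ▸ hw)
      simpa [this] using hcS w hw
  refine ⟨Finset.univ.sup c, c, ⟨?_, hcprop, hcgr⟩, hcS⟩
  ext j
  simp only [Set.mem_range, Set.mem_Icc]
  constructor
  · rintro ⟨v, rfl⟩
    exact ⟨hcpos v, Finset.le_sup (Finset.mem_univ v)⟩
  · rintro ⟨h1, h2⟩
    obtain ⟨v, -, hv⟩ := (Finset.le_sup_iff (Nat.lt_of_lt_of_le Nat.zero_lt_one h1)).1 h2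
    rcases hv.eq_or_lt with h | h
    · exact ⟨v, h.symm⟩
    · obtain ⟨u, -, hu⟩ := hcgr v j h1 h
      exact ⟨u, hu⟩

/-- The graph contains no partial Grundy coloring with `v ↦ 4`, `a ↦ 3`, `b, a₂ ↦ 2` and
`c, a₁, b₁, d ↦ 1`. -/
def NoFourWitness (G : SimpleGraph V) : Prop :=
  ∀ v a b c a₁ a₂ b₁ d, G.Adj v a → G.Adj v b → G.Adj v c → G.Adj a a₁ → G.Adj a a₂ →
    G.Adj b b₁ → G.Adj a₂ d → G.Adj b a₂ ∨ G.Adj c a₁ ∨ G.Adj c b₁ ∨ G.Adj c d ∨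
      G.Adj a₁ b₁ ∨ G.Adj a₁ d ∨ G.Adj b₁ d

theorem noFourWitness_of_grundyNumber_le_three [Fintype V] (h : G.grundyNumber ≤ 3) :
    G.NoFourWitness := by
  classical
  intro v a b c a₁ a₂ b₁ d hva hvb hvc haa₁ haa₂ hbb₁ hd
  by_contra! ⟨n1, n2, n3, n4, n5, n6, n7⟩
  have ns {x y : V} (h : ¬ G.Adj x y) : ¬ G.Adj y x := fun h' => h h'.symm
  let p : V → ℕ := fun w =>
    if w = v then 4 else if w = a then 3 else if w = b ∨ w = a₂ then 2 else 1
  let T : Set V := {w | w = c ∨ w = a₁ ∨ w = b₁ ∨ w = d}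
  have irr (x : V) : ¬ G.Adj x x := G.irrefl
  have T1 : ∀ x ∈ T, ∀ y ∈ T, ¬ G.Adj x y := by
    rintro x (rfl | rfl | rfl | rfl) y (rfl | rfl | rfl | rfl) <;>
      first | assumption | exact irr _ | exact ns ‹_›
  have hc : c ∈ T := .inl rfl
  have ha₁ : a₁ ∈ T := .inr (.inl rfl)
  have hb₁ : b₁ ∈ T := .inr (.inr (.inl rfl))
  have hd' : d ∈ T := .inr (.inr (.inr rfl))
  -- The vertices of color 1 may coincide, as may `b` and `a₂`. Distinct color classes are
  -- automatically disjoint: each higher vertex has a neighbor in the independent set `T`.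
  have vT : v ∉ T := fun h => T1 _ h _ hc hvc
  have aT : a ∉ T := fun h => T1 _ h _ ha₁ haa₁
  have bT : b ∉ T := fun h => T1 _ h _ hb₁ hbb₁
  have a₂T : a₂ ∉ T := fun h => T1 _ h _ hd' hd
  have va : a ≠ v := hva.ne'
  have vb : b ≠ v := hvb.ne'
  have va₂ : a₂ ≠ v := by rintro rfl; exact n1 hvb.symm
  have ab : b ≠ a := by rintro rfl; exact n1 haa₂
  have aa₂ : a₂ ≠ a := haa₂.ne'
  have pv : p v = 4 := by simp [p]
  have pa : p a = 3 := by simp [p, va]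
  have pb : p b = 2 := by simp [p, vb, ab]
  have pa₂ : p a₂ = 2 := by simp [p, va₂, aa₂]
  have pT : ∀ x ∈ T, p x = 1 := by
    intro x hx
    have h1 : x ≠ v := fun h => vT (h ▸ hx)
    have h2 : x ≠ a := fun h => aT (h ▸ hx)
    have h3 : x ≠ b := fun h => bT (h ▸ hx)
    have h4 : x ≠ a₂ := fun h => a₂T (h ▸ hx)
    simp [p, h1, h2, h3, h4]
  obtain ⟨k, col, hcol, hS⟩ := exists_isGrundyColoring_extending G
    ({w | w = v ∨ w = a ∨ w = b ∨ w = a₂ ∨ w ∈ T}) p (by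
      rintro x (rfl | rfl | rfl | rfl | hx) <;> grind) (by
      rintro x (rfl | rfl | rfl | rfl | hx) y (rfl | rfl | rfl | rfl | hy) hxy <;> grind) (by
      rintro x (rfl | rfl | rfl | rfl | hx) j hj1 hj
      · have : j = 1 ∨ j = 2 ∨ j = 3 := by lia
        rcases this with rfl | rfl | rfl
        · exact ⟨c, by simp [hc], hvc, pT _ hc⟩
        · exact ⟨b, by simp, hvb, pb⟩
        · exact ⟨a, by simp, hva, pa⟩
      · have : j = 1 ∨ j = 2 := by lia
        rcases this with rfl | rfl
        · exact ⟨a₁, by simp [ha₁], haa₁, pT _ ha₁⟩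
        · exact ⟨a₂, by simp, haa₂, pa₂⟩
      · exact ⟨b₁, by simp [hb₁], hbb₁, by rw [pT _ hb₁]; lia⟩
      · exact ⟨d, by simp [hd'], hd, by rw [pT _ hd']; lia⟩
      · rw [pT _ hx] at hj; lia)
  have hk : col v ∈ Set.Icc 1 k := hcol.range_eq ▸ Set.mem_range_self v
  have hk4 : col v = 4 := (hS v (.inl rfl)).trans pv
  have := G.isGreatest_grundyNumber.2 ⟨col, hcol⟩
  have := hk.2
  lia

/-- If `c x < c y`, then `y` has a neighbor of color `c x`, which is also a neighbor of `x`: not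
proper. -/
theorem IsGrundyColoring.eq_of_neighborSet_eq {k : ℕ} {c : V → ℕ} (hc : G.IsGrundyColoring k c)
    {x y : V} (h : G.neighborSet x = G.neighborSet y) : c x = c y := by
  have key : ∀ x y, G.neighborSet x = G.neighborSet y → ¬ c x < c y := by
    intro x y h hlt
    have hx : c x ∈ Set.Icc 1 k := hc.range_eq ▸ Set.mem_range_self x
    obtain ⟨u, hu, hux⟩ := hc.grundy y (c x) hx.1 hlt
    have : u ∈ G.neighborSet x := h ▸ hu
    exact hc.proper x u this hux.symm
  exact le_antisymm (not_lt.1 (key y x h.symm)) (not_lt.1 (key x y h))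

/-! ### Cubic neighborhoods and twins -/

/-- `u` has exactly the three distinct neighbors `p`, `q`, `r`. -/
structure HasNeighbors (G : SimpleGraph V) (u p q r : V) : Prop where
  adj_iff : ∀ w, G.Adj u w ↔ w = p ∨ w = q ∨ w = r
  ne₁₂ : p ≠ q
  ne₁₃ : p ≠ r
  ne₂₃ : q ≠ r

theorem IsRegularOfDegree.exists_hasNeighbors [Fintype V] [DecidableRel G.Adj]
    (hG : G.IsRegularOfDegree 3) (u : V) : ∃ p q r, G.HasNeighbors u p q r := by
  classical
  have h : (G.neighborFinset u).card = 3 := hG u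
  obtain ⟨p, q, r, h1, h2, h3, h4⟩ := Finset.card_eq_three.1 h
  refine ⟨p, q, r, fun w => ?_, h1, h2, h3⟩
  rw [← mem_neighborFinset, h4]
  simp

theorem HasNeighbors.rotate {u p q r : V} (h : G.HasNeighbors u p q r) :
    G.HasNeighbors u q r p :=
  ⟨fun w => by rw [h.adj_iff]; tauto, h.ne₂₃, h.ne₁₂.symm, h.ne₁₃.symm⟩

theorem HasNeighbors.swap {u p q r : V} (h : G.HasNeighbors u p q r) :
    G.HasNeighbors u p r q :=
  ⟨fun w => by rw [h.adj_iff]; tauto, h.ne₁₃, h.ne₁₂, h.ne₂₃.symm⟩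

theorem HasNeighbors.adj {u p q r : V} (h : G.HasNeighbors u p q r) :
    G.Adj u p ∧ G.Adj u q ∧ G.Adj u r := by
  simp [h.adj_iff]

/-- A neighbor of a vertex of a cubic graph can be listed first. -/
theorem exists_hasNeighbors_of_adj (hG : ∀ u, ∃ p q r, G.HasNeighbors u p q r) {u p : V}
    (h : G.Adj u p) : ∃ q r, G.HasNeighbors u p q r := by
  obtain ⟨x, y, z, hu⟩ := hG u
  rcases (hu.adj_iff p).1 h with rfl | rfl | rfl
  · exact ⟨_, _, hu⟩
  · exact ⟨_, _, hu.rotate⟩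
  · exact ⟨_, _, hu.rotate.rotate⟩

theorem exists_hasNeighbors_of_adj_of_adj (hG : ∀ u, ∃ p q r, G.HasNeighbors u p q r) {u p q : V}
    (h : G.Adj u p) (h' : G.Adj u q) (hpq : p ≠ q) : ∃ r, G.HasNeighbors u p q r := by
  obtain ⟨x, y, hu⟩ := exists_hasNeighbors_of_adj hG h
  rcases (hu.adj_iff q).1 h' with rfl | rfl | rfl
  · exact absurd rfl hpq
  · exact ⟨_, hu⟩
  · exact ⟨_, hu.swap⟩

theorem HasNeighbors.neighborSet_eq {u p q r : V} (h : G.HasNeighbors u p q r) :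
    G.neighborSet u = {p, q, r} := by
  ext w
  simp [h.adj_iff]

theorem HasNeighbors.congr {u u' p q r : V} (h : G.HasNeighbors u p q r)
    (h' : G.HasNeighbors u' p q r) : G.neighborSet u = G.neighborSet u' := by
  rw [h.neighborSet_eq, h'.neighborSet_eq]

/-- The neighborhood of `v` contains two distinct vertices with the same neighborhood. -/
def HasTwinNeighbors (G : SimpleGraph V) (v : V) : Prop :=
  ∃ x y, G.Adj v x ∧ G.Adj v y ∧ x ≠ y ∧ G.neighborSet x = G.neighborSet y

theorem isIndependentModule_pair {x y : V} (h : G.neighborSet x = G.neighborSet y) :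
    G.IsIndependentModule {x, y} := by
  have hxy : ¬ G.Adj x y := fun hxy => by
    have : y ∈ G.neighborSet y := h ▸ hxy
    exact G.irrefl this
  constructor
  · rintro a (rfl | rfl) b (rfl | rfl) hab
    · exact absurd rfl hab
    · exact hxy
    · exact fun h' => hxy h'.symm
    · exact absurd rfl hab
  · rintro a (rfl | rfl) b (rfl | rfl) <;> first | rfl | exact h | exact h.symm

theorem isZeroTwinVertex_three_iff (v : V) :
    G.IsZeroTwinVertex 3 3 v ↔ ∃ x, x ≠ v ∧ G.neighborSet x = G.neighborSet v := by
  classical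
  constructor
  · rintro ⟨X, hv, hcard, hX⟩
    have : 1 < X.card := by lia
    obtain ⟨x, hx, hxv⟩ := Finset.exists_mem_ne this v
    exact ⟨x, hxv, hX.2 x hx v hv⟩
  · rintro ⟨x, hxv, h⟩
    refine ⟨{x, v}, by simp, by rw [Finset.card_pair hxv], ?_⟩
    rw [Finset.coe_pair]
    exact isIndependentModule_pair h

/-- Pigeonhole: three neighbors in at most two classes. Conversely, a twin pair and the remaining
singleton form the partition. -/
theorem isOneTwinVertex_three_iff (hG : ∀ u, ∃ p q r, G.HasNeighbors u p q r) (v : V) :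
    G.IsOneTwinVertex 3 v ↔ G.HasTwinNeighbors v := by
  classical
  constructor
  · rintro ⟨P, hcard, hP⟩
    obtain ⟨p, q, r, hv⟩ := hG v
    have hmem : ∀ w, G.Adj v w → ∃ X ∈ P.parts, w ∈ X := by
      intro w hw
      have : w ∈ P.parts.sup id := by rw [P.sup_parts]; exact hw
      rw [Finset.sup_id_set_eq_sUnion] at this
      exact this
    choose! F hF hF' using hmem
    have hsub : ({p, q, r} : Finset V).card = 3 :=
      Finset.card_eq_three.2 ⟨p, q, r, hv.ne₁₂, hv.ne₁₃, hv.ne₂₃, rfl⟩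
    have hadj : ∀ w ∈ ({p, q, r} : Finset V), G.Adj v w := by
      intro w hw
      rw [hv.adj_iff]
      simpa using hw
    obtain ⟨x, hx, y, hy, hxy, hF2⟩ := Finset.exists_ne_map_eq_of_card_lt_of_maps_to
      (s := ({p, q, r} : Finset V)) (t := P.parts) (f := F) (by lia)
      (fun w hw => hF w (hadj w hw))
    refine ⟨x, y, hadj x hx, hadj y hy, hxy, (hP _ (hF x (hadj x hx))).2 x (hF' x (hadj x hx)) y ?_⟩
    rw [hF2]
    exact hF' y (hadj y hy)
  · rintro ⟨x, y, hx, hy, hxy, h⟩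
    obtain ⟨z, hv⟩ := exists_hasNeighbors_of_adj_of_adj hG hx hy hxy
    have hne : ({x, y} : Set V) ≠ ⊥ := (Set.insert_nonempty x {y}).ne_empty
    have hne' : ({z} : Set V) ≠ ⊥ := (Set.singleton_nonempty z).ne_empty
    have hdisj : Disjoint ({x, y} : Set V) {z} := by
      simp [Set.disjoint_singleton_right, hv.ne₁₃.symm, hv.ne₂₃.symm]
    have hsup : ({x, y} : Set V) ⊔ {z} = G.neighborSet v := by
      rw [hv.neighborSet_eq]
      ext w
      simp
      tauto
    refine ⟨(Finpartition.indiscrete hne).extend hne' hdisj hsup, ?_, ?_⟩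
    · rw [Finpartition.card_extend]
      simp
    · intro X hX
      simp only [Finpartition.extend_parts, Finpartition.indiscrete_parts, Finset.mem_insert,
        Finset.mem_singleton] at hX
      rcases hX with rfl | rfl
      · simpa using isIndependentModule_pair (G := G) (rfl : G.neighborSet z = G.neighborSet z)
      · exact isIndependentModule_pair h

/-! ### Twin conditions exclude color 4 -/

theorem grundyNumber_le_three_of_twins [Fintype V]
    (hG : ∀ u, ∃ p q r, G.HasNeighbors u p q r)
    (h : ∀ v : V, G.IsZeroTwinVertex 3 3 v ∨ G.IsOneTwinVertex 3 v ∨ G.IsTwoTwinVertex 3 v) :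
    G.grundyNumber ≤ 3 := by
  by_contra! hlt
  obtain ⟨c, hc⟩ := G.isGreatest_grundyNumber.1
  obtain ⟨v, hv⟩ : 4 ∈ Set.range c := by
    rw [hc.range_eq]
    exact ⟨by lia, hlt⟩
  obtain ⟨a, hva, ha⟩ := hc.grundy v 3 (by lia) (by lia)
  obtain ⟨b, hvb, hb⟩ := hc.grundy v 2 (by lia) (by lia)
  obtain ⟨d, hvd, hd⟩ := hc.grundy v 1 (by lia) (by lia)
  obtain ⟨x, hax, hx⟩ := hc.grundy a 2 (by lia) (by lia)
  obtain ⟨y, hay, hy⟩ := hc.grundy a 1 (by lia) (by lia)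
  have ne {p q : V} (h : c p ≠ c q) : p ≠ q := fun h' => h (h' ▸ rfl)
  have no_twins : ∀ {u p q r : V}, G.Adj u p → G.Adj u q → G.Adj u r → c p ≠ c q → c p ≠ c r →
      c q ≠ c r → ¬ G.HasTwinNeighbors u := by
    rintro u p q r hp hq hr h1 h2 h3 ⟨s, t, hs, ht, hst, heq⟩
    obtain ⟨r', hu⟩ := exists_hasNeighbors_of_adj_of_adj hG hp hq (ne h1)
    obtain rfl : r = r' := by
      rcases (hu.adj_iff r).1 hr with rfl | rfl | h
      · exact absurd rfl h2
      · exact absurd rfl h3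
      · exact h
    have := hc.eq_of_neighborSet_eq heq
    rcases (hu.adj_iff s).1 hs with rfl | rfl | rfl <;>
      rcases (hu.adj_iff t).1 ht with rfl | rfl | rfl <;> grind
  have nv : ¬ G.HasTwinNeighbors v := no_twins hva hvb hvd (by lia) (by lia) (by lia)
  have na : ¬ G.HasTwinNeighbors a := no_twins hva.symm hax hay (by lia) (by lia) (by lia)
  rcases h v with h | h | h
  -- A twin of `v` is also adjacent to `a`, so `a` would have twin neighbors.
  · obtain ⟨w, hwv, hw⟩ := (isZeroTwinVertex_three_iff v).1 h
    have haw : G.Adj w a := by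
      have : a ∈ G.neighborSet w := hw ▸ hva
      exact this
    exact na ⟨w, v, haw.symm, hva.symm, hwv, hw⟩
  · exact nv ((isOneTwinVertex_three_iff hG v).1 h)
  · exact na ((isOneTwinVertex_three_iff hG a).1 (h.2 a hva))

/-! ### Triangles -/

theorem NoFourWitness.triangle_aux (hG : ∀ u, ∃ p q r, G.HasNeighbors u p q r)
    (hL : G.NoFourWitness) {u₁ u₂ u₃ p₁ p₂ p₃ : V} (h₁ : G.HasNeighbors u₁ u₂ u₃ p₁)
    (h₂ : G.HasNeighbors u₂ u₁ u₃ p₂) (h₃ : G.HasNeighbors u₃ u₁ u₂ p₃)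
    (h13 : p₁ ≠ p₃) (h23 : p₂ ≠ p₃) : ¬ G.Adj p₁ p₂ := by
  intro h
  obtain ⟨a1, a2, a3⟩ := h₁.adj
  obtain ⟨b1, b2, b3⟩ := h₂.adj
  obtain ⟨c1, c2, c3⟩ := h₃.adj
  obtain ⟨q, hp⟩ := exists_hasNeighbors_of_adj_of_adj hG a3.symm h h₂.ne₁₃
  have p1 := hp.adj.2.2
  -- Colors: `u₁` 4, `p₁` 3, `u₃` and `p₂` 2, `u₂` and `q` 1.
  have := hL u₁ p₁ u₃ u₂ q p₂ u₂ u₂ a3 a2 a1 p1 h c2 b3.symm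
  grind [HasNeighbors, G.adj_comm, G.irrefl]

/-- In a triangle, two of the three remaining neighbors coincide and are adjacent to the third. -/
theorem NoFourWitness.triangle (hG : ∀ u, ∃ p q r, G.HasNeighbors u p q r)
    (hL : G.NoFourWitness) {u₁ u₂ u₃ p₁ p₂ p₃ : V} (h₁ : G.HasNeighbors u₁ u₂ u₃ p₁)
    (h₂ : G.HasNeighbors u₂ u₁ u₃ p₂) (h₃ : G.HasNeighbors u₃ u₁ u₂ p₃) :
    p₁ = p₂ ∧ G.Adj p₁ p₃ ∨ p₁ = p₃ ∧ G.Adj p₁ p₂ ∨ p₂ = p₃ ∧ G.Adj p₂ p₁ := by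
  have k1 := hL.triangle_aux hG h₁ h₂ h₃
  have k2 := hL.triangle_aux hG h₁.rotate.swap h₃ h₂
  have k3 := hL.triangle_aux hG h₂.rotate.swap h₃.rotate.swap h₁
  obtain ⟨a1, a2, a3⟩ := h₁.adj
  obtain ⟨b1, b2, b3⟩ := h₂.adj
  obtain ⟨c1, c2, c3⟩ := h₃.adj
  -- Coloring the triangle 4, 3, 2 and its outer neighbors 1 must fail, so two outer neighbors are
  -- adjacent; `k1`, `k2`, `k3` then force a coincidence with the third.
  have t1 := hL u₃ u₁ u₂ p₃ p₁ u₂ p₂ p₂ c1 c2 c3 a3 a1 b3 b3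
  have t2 := hL u₁ u₃ u₂ p₁ p₃ u₂ p₂ p₂ a2 a1 a3 c3 c2 b3 b3
  have irr (x : V) : ¬ G.Adj x x := G.irrefl
  by_cases e12 : p₁ = p₂ <;> by_cases e13 : p₁ = p₃ <;> by_cases e23 : p₂ = p₃ <;>
    grind [G.adj_comm]

/-- `v` lies in no triangle, has no twin, and no two of its neighbors are twins. -/
structure IsTwinFree (G : SimpleGraph V) (v : V) : Prop where
  indep : ∀ x y, G.Adj v x → G.Adj v y → ¬ G.Adj x y
  no_twins : ¬ G.HasTwinNeighbors v
  no_twin : ∀ x, G.neighborSet x = G.neighborSet v → x = v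

/-- By `NoFourWitness.triangle`, the outer neighbor shared by two vertices of a triangle is a twin
of its third vertex, which is `v` or a neighbor of `v`. -/
theorem NoFourWitness.indep (hG : ∀ u, ∃ p q r, G.HasNeighbors u p q r) (hL : G.NoFourWitness)
    {v : V} (h1 : ¬ G.HasTwinNeighbors v) (h2 : ∀ x, G.neighborSet x = G.neighborSet v → x = v)
    (x y : V) (hx : G.Adj v x) (hy : G.Adj v y) : ¬ G.Adj x y := by
  intro hxy
  obtain ⟨c, hv⟩ := exists_hasNeighbors_of_adj_of_adj hG hx hy hxy.ne
  obtain ⟨a, ha⟩ := exists_hasNeighbors_of_adj_of_adj hG hx.symm hxy hy.ne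
  obtain ⟨b, hb⟩ := exists_hasNeighbors_of_adj_of_adj hG hy.symm hxy.symm hx.ne
  have twin : ∀ s t, G.Adj v s → G.Adj v t → G.neighborSet s = G.neighborSet t → s = t :=
    fun s t hs ht h => by_contra fun hst => h1 ⟨s, t, hs, ht, hst, h⟩
  rcases hL.triangle hG hv ha hb with ⟨rfl, h⟩ | ⟨rfl, h⟩ | ⟨rfl, h⟩
  · obtain ⟨z, hz⟩ := exists_hasNeighbors_of_adj_of_adj hG hv.adj.2.2.symm ha.adj.2.2.symm hx.ne
    have := twin y c hy hv.adj.2.2 (by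
      rcases (hz.adj_iff b).1 h with e | e | rfl
      · exact absurd e hb.ne₁₃.symm
      · exact absurd e hb.ne₂₃.symm
      · exact hb.congr hz)
    exact hv.ne₂₃ this
  · obtain ⟨z, hz⟩ := exists_hasNeighbors_of_adj_of_adj hG hv.adj.2.2.symm hb.adj.2.2.symm hy.ne
    have := twin x c hx hv.adj.2.2 (by
      rcases (hz.adj_iff a).1 h with e | e | rfl
      · exact absurd e ha.ne₁₃.symm
      · exact absurd e ha.ne₂₃.symm
      · exact ha.congr hz)
    exact hv.ne₁₃ this
  · obtain ⟨z, hz⟩ := exists_hasNeighbors_of_adj_of_adj hG ha.adj.2.2.symm hb.adj.2.2.symm hxy.ne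
    have := h2 a (by
      rcases (hz.adj_iff c).1 h with e | e | rfl
      · exact absurd e hv.ne₁₃.symm
      · exact absurd e hv.ne₂₃.symm
      · exact hz.congr hv)
    exact ha.ne₁₃ this.symm

theorem NoFourWitness.isTwinFree (hG : ∀ u, ∃ p q r, G.HasNeighbors u p q r)
    (hL : G.NoFourWitness) {v : V} (h1 : ¬ G.HasTwinNeighbors v)
    (h2 : ∀ x, G.neighborSet x = G.neighborSet v → x = v) : G.IsTwinFree v :=
  ⟨hL.indep hG h1 h2, h1, h2⟩

/-! ### 4-cycles through a twin-free vertex -/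

/-- Without a witness, no two neighbors of a twin-free vertex have another common neighbor. -/
theorem NoFourWitness.no_square (hG : ∀ u, ∃ p q r, G.HasNeighbors u p q r)
    (hL : G.NoFourWitness) {v a b x : V} (hv : G.IsTwinFree v) (ha : G.Adj v a) (hb : G.Adj v b)
    (hab : a ≠ b) (hxv : x ≠ v) (hax : G.Adj a x) : ¬ G.Adj b x := by
  intro hbx
  obtain ⟨c, nv⟩ := exists_hasNeighbors_of_adj_of_adj hG ha hb hab
  obtain ⟨y, na⟩ := exists_hasNeighbors_of_adj_of_adj hG ha.symm hax hxv.symm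
  obtain ⟨b', nb⟩ := exists_hasNeighbors_of_adj_of_adj hG hb.symm hbx hxv.symm
  obtain ⟨x', nx⟩ := exists_hasNeighbors_of_adj_of_adj hG hax.symm hbx.symm hab
  obtain ⟨p, q, nc⟩ := exists_hasNeighbors_of_adj hG nv.adj.2.2.symm
  obtain ⟨d₁, d₂, nb'⟩ := exists_hasNeighbors_of_adj hG nb.adj.2.2.symm
  obtain ⟨e₁, e₂, nx'⟩ := exists_hasNeighbors_of_adj hG nx.adj.2.2.symm
  have irr (w : V) : ¬ G.Adj w w := G.irrefl
  have vc := nv.adj.2.2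
  have ay := na.adj.2.2
  have bb' := nb.adj.2.2
  have xx' := nx.adj.2.2
  obtain ⟨-, cp, cq⟩ := nc.adj
  obtain ⟨-, hd₁, hd₂⟩ := nb'.adj
  obtain ⟨-, he₁, he₂⟩ := nx'.adj
  have iab := hv.indep _ _ ha hb
  have iac := hv.indep _ _ ha vc
  have ibc := hv.indep _ _ hb vc
  have cx : ¬ G.Adj c x := fun h => by
    rcases (nx.adj_iff c).1 h.symm with rfl | rfl | rfl
    · exact nv.ne₁₃ rfl
    · exact nv.ne₂₃ rfl
    · exact hxv (hv.no_twin x (nx.congr nv))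
  have yb : y ≠ b' := fun h =>
    hv.no_twins ⟨a, b, ha, hb, hab, na.congr (h ▸ nb)⟩
  have vy : v ≠ y := na.ne₁₃
  have xy : x ≠ y := na.ne₂₃
  have by' : ¬ G.Adj b y := fun h => by
    rcases (nb.adj_iff y).1 h with h | h | h
    · exact vy h.symm
    · exact xy h.symm
    · exact yb h
  have ab' : ¬ G.Adj a b' := fun h => by
    rcases (na.adj_iff b').1 h with h | h | h
    · exact nb.ne₁₃ h.symm
    · exact nb.ne₂₃ h.symm
    · exact yb h.symm
  have vx' : ¬ G.Adj v x' := fun h => by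
    rcases (nv.adj_iff x').1 h with h | h | h
    · exact nx.ne₁₃ h.symm
    · exact nx.ne₂₃ h.symm
    · exact cx (h ▸ xx'.symm)
  -- Each application of `hL` below places the pattern near the 4-cycle `v a x b`; all but the
  -- desired alternatives are already excluded.
  have cy : ¬ G.Adj y c := fun h => by
    have := hL v a b c x y x c ha hb vc hax ay hbx h
    grind [G.adj_comm]
  have xy' : ¬ G.Adj y x := fun h => by
    have := hL v a b c x y x x ha hb vc hax ay hbx h
    grind [G.adj_comm]
  have kc : ∀ w, G.Adj c w → G.Adj b w ∨ G.Adj y w := fun w hw => by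
    have := hL v a c b y x w b ha vc hb ay hax hw hbx.symm
    grind [G.adj_comm]
  have kb' : ∀ w, G.Adj b' w → G.Adj c w ∨ G.Adj x w := fun w hw => by
    have := hL v b a c x b' x w hb ha vc hbx bb' hax hw
    grind [G.adj_comm]
  have kx' : ∀ w, G.Adj x' w → G.Adj y w ∨ G.Adj b w := fun w hw => by
    have := hL a x v y b x' b w hax ha.symm ay hbx.symm xx' hb hw
    grind [G.adj_comm]
  have cb' : ¬ G.Adj b' c := fun h => by
    have := kb' c h
    grind [G.adj_comm]
  have xb' : ¬ G.Adj b' x := fun h => by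
    have := kb' x h
    grind [G.adj_comm]
  have yc : ∀ w, G.Adj c w → w ≠ v → G.Adj y w := fun w hw hwv => by
    rcases kc w hw with h | h
    · rcases (nb.adj_iff w).1 h with rfl | rfl | rfl
      · exact absurd rfl hwv
      · exact absurd hw cx
      · exact absurd hw.symm cb'
    · exact h
  have yp := yc p cp nc.ne₁₂.symm
  have yq := yc q cq nc.ne₁₃.symm
  have key : ∀ p q, G.Adj c p → G.Adj c q → p ≠ v → q ≠ v → G.Adj b' p → G.Adj b' q := by
    intro p q cp cq pv qv hp
    have aq : ¬ G.Adj a q := fun h => by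
      rcases (na.adj_iff q).1 h with rfl | rfl | rfl
      · exact qv rfl
      · exact cx cq
      · exact cy cq.symm
    have bp : ¬ G.Adj b p := fun h => by
      rcases (nb.adj_iff p).1 h with rfl | rfl | rfl
      · exact pv rfl
      · exact cx cp
      · exact irr _ hp
    have := hL v c b a q p b' b' vc hb ha cq cp bb' hp.symm
    grind [G.adj_comm]
  have vb' : ¬ G.Adj b' v := fun h => hv.indep _ _ hb h.symm bb'
  have nd : ∀ w, G.Adj b' w → w ≠ b → w = p ∨ w = q ∨ w = x' := by
    intro w hw hwb
    have h1 := nc.adj_iff w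
    have h2 := nx.adj_iff w
    have h3 : w ≠ v := fun h => vb' (h ▸ hw)
    have h4 : w ≠ a := fun h => ab' (h ▸ hw.symm)
    rcases kb' w hw with h | h
    · rcases h1.1 h with h | h | h <;> tauto
    · rcases h2.1 h with h | h | h <;> tauto
  -- `b'` has two neighbors other than `b` among `p`, `q`, `x'`, so it meets `p` or `q`, and by
  -- `key` both.
  have b'p : G.Adj b' p := by
    by_contra hn
    have hn' : ¬ G.Adj b' q := fun h => hn (key q p cq cp nc.ne₁₃.symm nc.ne₁₂.symm h)
    have h1 := nd d₁ hd₁ nb'.ne₁₂.symm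
    have h2 := nd d₂ hd₂ nb'.ne₁₃.symm
    have h3 := nb'.ne₂₃
    grind
  have b'q := key p q cp cq nc.ne₁₂.symm nc.ne₁₃.symm b'p
  have xc : ∀ w, G.Adj x w → w ≠ c ∧ w ≠ y ∧ w ≠ b' := fun w hw =>
    ⟨fun h => cx (h ▸ hw.symm), fun h => xy' (h ▸ hw.symm), fun h => xb' (h ▸ hw.symm)⟩
  -- Now `p` and `q` have neighborhood exactly {`c`, `y`, `b'`}, which leaves no room for other
  -- neighbors.
  have key' : ∀ u w, G.Adj c w → G.Adj y w → G.Adj b' w → u ≠ c → u ≠ y → u ≠ b' →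
      ¬ G.Adj u w := by
    intro u w h1 h2 h3 hu1 hu2 hu3 h4
    have hcb' : c ≠ b' := fun h => ibc (h ▸ bb')
    have hyc : y ≠ c := fun h => iac (h ▸ ay)
    obtain ⟨z, nw⟩ := exists_hasNeighbors_of_adj_of_adj hG h1.symm h2.symm hyc.symm
    have h5 := (nw.adj_iff b').1 h3.symm
    have h6 := (nw.adj_iff u).1 h4.symm
    grind
  obtain ⟨x'c, x'y, x'b⟩ := xc x' xx'
  have x'p := key' x' p cp yp b'p x'c x'y x'b
  have x'q := key' x' q cq yq b'q x'c x'y x'b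
  have xc' : x ≠ c := fun h => ibc (h ▸ hbx)
  have xb : x ≠ b' := nb.ne₂₃
  have xp := key' x p cp yp b'p xc' xy xb
  have xq := key' x q cq yq b'q xc' xy xb
  have bp : b ≠ p := fun h => ibc (h ▸ cp.symm)
  have bq : b ≠ q := fun h => ibc (h ▸ cq.symm)
  have ap : a ≠ p := fun h => iac (h ▸ cp.symm)
  have aq : a ≠ q := fun h => iac (h ▸ cq.symm)
  obtain ⟨z, nb''⟩ := exists_hasNeighbors_of_adj_of_adj hG bb'.symm b'p bp
  obtain ⟨w, ny⟩ := exists_hasNeighbors_of_adj_of_adj hG ay.symm yp ap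
  have hz := (nb''.adj_iff q).1 b'q
  have hw := (ny.adj_iff q).1 yq
  have hpq := nc.ne₂₃
  -- `e₁` must be a neighbor of `y` (`a`, `p` or `q`) or of `b` (`v`, `x` or `b'`), but none of
  -- these can be a neighbor of `x'` other than `x`.
  rcases kx' e₁ he₁ with h | h
  · have hax' : ¬ G.Adj x' a := fun h' => by
      have := (na.adj_iff x').1 h'.symm
      grind [G.adj_comm]
    have := (ny.adj_iff e₁).1 h
    grind
  · have h1 := (nb.adj_iff e₁).1 h
    have h2 : ¬ G.Adj x' b' := fun h' => by
      have := (nb''.adj_iff x').1 h'.symm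
      have hbx' := nx.ne₂₃
      grind
    grind [nx'.ne₁₂, G.adj_comm]

/-! ### Neighbors of a twin-free vertex -/

/-- If `v` is twin-free, every neighbor of `v` has twin neighbors. -/
theorem NoFourWitness.hasTwinNeighbors (hG : ∀ u, ∃ p q r, G.HasNeighbors u p q r)
    (hL : G.NoFourWitness) {v a : V} (hv : G.IsTwinFree v) (hva : G.Adj v a) :
    G.HasTwinNeighbors a := by
  by_contra h1
  -- A twin of `a` would be another neighbor of `v`. So triangles and 4-cycles are excluded at `a`
  -- as well as at `v`.
  have ha : G.IsTwinFree a := hL.isTwinFree hG h1 fun x hx => by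
    by_contra hxa
    have : v ∈ G.neighborSet x := hx ▸ hva.symm
    exact hv.no_twins ⟨x, a, this.symm, hva, hxa, hx⟩
  obtain ⟨b, c, nv⟩ := exists_hasNeighbors_of_adj hG hva
  obtain ⟨x, y, na⟩ := exists_hasNeighbors_of_adj hG hva.symm
  obtain ⟨b₁, b₂, nb⟩ := exists_hasNeighbors_of_adj hG nv.adj.2.1.symm
  obtain ⟨x₁, x₂, nx⟩ := exists_hasNeighbors_of_adj hG na.adj.2.1.symm
  obtain ⟨y₁, y₂, ny⟩ := exists_hasNeighbors_of_adj hG na.adj.2.2.symm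
  have sqv := fun p q r => hL.no_square hG (a := p) (b := q) (x := r) hv
  have sqa := fun p q r => hL.no_square hG (a := p) (b := q) (x := r) ha
  obtain ⟨-, vb, vc⟩ := nv.adj
  obtain ⟨-, ax, ay⟩ := na.adj
  have iv := hv.indep
  have ia := ha.indep
  have iy : ∀ y, G.Adj a y → ¬ G.Adj y v := fun y ay => ia _ _ ay hva.symm
  have bv₁ : b₁ ≠ v := nb.ne₁₂.symm
  have key : ∀ {x y η}, G.Adj a x → G.Adj a y → x ≠ v → y ≠ v → x ≠ y → G.Adj y η → η ≠ a →
      G.Adj b₁ η := by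
    intro x y η ax ay xv yv xy yη ηa
    have bx : ¬ G.Adj b x := sqv a b x hva vb nv.ne₁₂ xv ax
    have by' : ¬ G.Adj b y := sqv a b y hva vb nv.ne₁₂ yv ay
    have cx : ¬ G.Adj c x := sqv a c x hva vc nv.ne₁₃ xv ax
    have cy : ¬ G.Adj c y := sqv a c y hva vc nv.ne₁₃ yv ay
    have cb₁ : ¬ G.Adj c b₁ := sqv b c b₁ vb vc nv.ne₂₃ bv₁ nb.adj.2.1
    have xη : ¬ G.Adj x η := sqa y x η ay ax xy.symm ηa yη
    have vη : η ≠ v := fun h => iy y ay (h ▸ yη)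
    have ab₁ : b₁ ≠ a := fun h => iv _ _ hva vb (h ▸ nb.adj.2.1).symm
    have cη : ¬ G.Adj c η := fun h => by
      have bη := sqv c b η vc vb nv.ne₂₃.symm vη h
      have := hL v a c b x y η η hva vc vb ax ay h yη
      grind [G.adj_comm, G.irrefl]
    have xb₁ : ¬ G.Adj x b₁ := fun h => by
      have yb₁ := sqa x y b₁ ax ay xy ab₁ h
      have := hL v a b c y x b₁ b₁ hva vb vc ay ax nb.adj.2.1 h
      grind [G.adj_comm, G.irrefl]
    -- The edge `b₁ η` is the only alternative left.
    have := hL v a b c x y b₁ η hva vb vc ax ay nb.adj.2.1 yη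
    tauto
  have vx := na.ne₁₂.symm
  have vy := na.ne₁₃.symm
  have h1 := key ax ay vx vy na.ne₂₃ ny.adj.2.1 ny.ne₁₂.symm
  have h2 := key ax ay vx vy na.ne₂₃ ny.adj.2.2 ny.ne₁₃.symm
  have h3 := key ay ax vy vx na.ne₂₃.symm nx.adj.2.1 nx.ne₁₂.symm
  -- `b₁` acquires four distinct neighbors `b`, `y₁`, `y₂`, `x₁`, too many for a cubic graph.
  obtain ⟨z, nb₁⟩ := exists_hasNeighbors_of_adj_of_adj hG h1 h2 ny.ne₂₃
  have bx : ¬ G.Adj x b := fun h => sqv a b x hva vb nv.ne₁₂ vx ax h.symm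
  have yb : ¬ G.Adj y b := fun h => sqv a b y hva vb nv.ne₁₂ vy ay h.symm
  have yx₁ := sqa x y x₁ ax ay na.ne₂₃ nx.ne₁₂.symm nx.adj.2.1
  have k1 := (nb₁.adj_iff b).1 nb.adj.2.1.symm
  have k2 := (nb₁.adj_iff x₁).1 h3
  have := nx.adj.2.1
  have := ny.adj.2
  grind

end SimpleGraph

theorem mainTheorem2 {V : Type*} [Fintype V] (G : SimpleGraph V) [DecidableRel G.Adj]
    (hG : G.IsRegularOfDegree 3) :
    G.grundyNumber ≤ 3 ↔
      ∀ v : V, G.IsZeroTwinVertex 3 3 v ∨ G.IsOneTwinVertex 3 v ∨ G.IsTwoTwinVertex 3 v := by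
  have hN := hG.exists_hasNeighbors
  refine ⟨fun h v => ?_, SimpleGraph.grundyNumber_le_three_of_twins hN⟩
  have hL := SimpleGraph.noFourWitness_of_grundyNumber_le_three h
  by_contra! ⟨h0, h1, h2⟩
  rw [SimpleGraph.isZeroTwinVertex_three_iff] at h0
  rw [SimpleGraph.isOneTwinVertex_three_iff hN] at h1
  have hv : G.IsTwinFree v := hL.isTwinFree hN h1 fun x hx => by
    by_contra hxv
    exact h0 ⟨x, hxv, hx⟩
  exact h2 ⟨fun x hx y hy _ => hv.indep x y hx hy, fun u hu =>
    (SimpleGraph.isOneTwinVertex_three_iff hN u).2 (hL.hasTwinNeighbors hN hv hu)⟩
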